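/- Let $\mathcal S=\mathcal S(\mathbb R,\mathbb C)$ be the Schwartz space of complex functions $u(x)$, with the real pairing $\langle P,v\rangle=\int_{\mathbb R}\mathrm{Re}(\bar P v)\,dx$, and let $D_x^{-1}f(x)=\tfrac12\big(\int_{-\infty}^x f-\int_x^\infty f\big)$. Let $\mathcal C$ denote complex conjugation, so that e.g. $u D_x^{-1}\mathrm{Im}(u\mathcal C)\,w=u\,D_x^{-1}\mathrm{Im}(u\bar w)$. An operator $\mathcal D=\mathcal D_u$ is a family, indexed by $u\in\mathcal S$, of real-linear maps $\mathcal S\to\mathcal S$. A functional is a map $\mathfrak F:\mathcal S\to\mathbb R$ that has a variational derivative $\delta\mathfrak F/\delta\bar u:\mathcal S\to\mathcal S$, i.e. $\frac{d}{dt}\big|_{0}\mathfrak F(u+tv)=2\langle\delta\mathfrak F/\delta\bar u,v\rangle$ for all $u,v$, which is continuously differentiable on the Fréchet space $\mathcal S$ (directional derivatives exist and are jointly continuous in point and direction). Write $\delta\mathfrak F/\delta u$ for the complex conjugate of $\delta\mathfrak F/\delta\bar u$. The operator $\mathcal D$ is *Hamiltonian* if the bracket $\{\mathfrak F,\mathfrak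 G\}=\int_{\mathbb R}\mathrm{Re}\big(\mathcal D(\delta\mathfrak F/\delta\bar u)\,\delta\mathfrak G/\delta u\big)dx$ of any two functionals has a variational derivative, is skew-symmetric, and satisfies the Jacobi identity $\{\mathfrak F,\{\mathfrak H,\mathfrak G\}\}+\text{cyclic}=0$ for all functionals. The operator $\mathcal D$ is *$U(1)$-invariant* if $e^{i\lambda}\mathcal D e^{-i\lambda}=\mathcal D|_{u\to e^{i\lambda}u}$ for all real $\lambda$. An operator $\mathcal R$ on flow vectors is *hereditary* if $\mathcal R'[\mathcal R v]w-\mathcal R\,\mathcal R'[v]w$ is symmetric in $v,w$, where $\mathcal R'[v]$ is the derivative of $\mathcal R$ with respect to $u$ in the direction $v$; it is a *recursion operator* of $u_t=K(u)$ if $\mathcal R'[K]=K'\mathcal R-\mathcal R K'$. An operator $\mathcal T$ on covectors (variational derivatives), with adjoint $\mathcal R$ determined by $\langle P,\mathcal R v\rangle=\langle\mathcal T P,v\rangle$, is *hereditary* if $\langle\mathcal T'[\mathcal R v]P,w\rangle-\langle\mathcal T'[v]\mathcal T P,w\rangle$ is symmetric in $v,w$ for every $P$, and a *recursion operator* of $u_t=K(u)$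 if $\langle\mathcal T'[K]P,w\rangle=\langle P,K'\mathcal R w\rangle-\langle\mathcal T P,K'w\rangle$ for all $P,w$. Let $\mathcal H=D_x-iuD_x^{-1}\mathrm{Im}(u\mathcal C)$ and $\mathcal I=-i$. Then: (i) $\mathcal H$ is a $U(1)$-invariant Hamiltonian operator. (ii) $\mathcal I$ is a $U(1)$-invariant Hamiltonian operator. (iii) $\mathcal H$ and $\mathcal I$ are compatible: $a\mathcal H+b\mathcal I$ is Hamiltonian for all $a,b\in\mathbb R$. The compositions $$\mathcal R=\mathcal H\mathcal I^{-1}=i\big(D_x+uD_x^{-1}\mathrm{Re}(u\mathcal C)\big),\qquad \mathcal R^*=\mathcal I^{-1}\mathcal H=iD_x-uD_x^{-1}\mathrm{Re}(iu\mathcal C)$$ are $U(1)$-invariant, $\mathcal R^*$ is the adjoint of $\mathcal R$, $\mathcal R$ is hereditary on flow vectors and $\mathcal R^*$ is hereditary on covectors, and both are recursion operators of every bi-Hamiltonian equation $u_t=K(u)=\mathcal H(\delta\mathfrak F/\delta\bar u)=\mathcal I(\delta\mathfrak G/\delta\bar u)$ with functionals $\mathfrak F,\mathfrak G$. (iv)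 $\mathcal E=\mathcal R\mathcal H$ is a $U(1)$-invariant Hamiltonian operator, $$\mathcal E=iD_x^2+D_x\big(uD_x^{-1}\mathrm{Im}(u\mathcal C)\big)+iuD_x^{-1}\mathrm{Re}(uD_x\mathcal C)=iD_x^2+i|u|^2+u_xD_x^{-1}\mathrm{Im}(u\mathcal C)-iuD_x^{-1}\mathrm{Re}(u_x\mathcal C),$$ and $\mathcal E,\mathcal H,\mathcal I$ form a compatible triple: $a\mathcal E+b\mathcal H+c\mathcal I$ is Hamiltonian for all $a,b,c\in\mathbb R$. -/

import Mathlib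

open MeasureTheory Topology
open scoped SchwartzMap ComplexConjugate

namespace HasimotoFlow

/-- The phase space: rapidly decreasing complex functions `u(x)` on the line. Flow vectors
(values of `u_t`) and covectors (values of `δF/δū`) lie in the same space. -/
abbrev Phase : Type := 𝓢(ℝ, ℂ)

/-- An operator depending on the flow variable: for every `u` a real-linear map. -/
abbrev OpField : Type := Phase → (Phase →ₗ[ℝ] Phase)

/-! ### The operator `D_x⁻¹` -/

/-- The skew-symmetric inverse of `D_x` on the line,
`(D_x⁻¹ f)(x) = ½ (∫_{-∞}^x f - ∫_x^∞ f)`. -/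
noncomputable def Dinv (f : ℝ → ℝ) (x : ℝ) : ℝ :=
  ((∫ y in Set.Iic x, f y) - ∫ y in Set.Ioi x, f y) / 2

theorem Dinv_add {f g : ℝ → ℝ} (hf : Integrable f) (hg : Integrable g) :
    Dinv (f + g) = Dinv f + Dinv g := by
  funext x
  simp only [Dinv, Pi.add_apply]
  rw [integral_add hf.integrableOn hg.integrableOn, integral_add hf.integrableOn hg.integrableOn]
  ring

theorem Dinv_smul (c : ℝ) (f : ℝ → ℝ) : Dinv (c • f) = c • Dinv f := by
  funext x
  simp only [Dinv, Pi.smul_apply, smul_eq_mul]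
  rw [integral_const_mul, integral_const_mul]
  ring

theorem Dinv_eq {f : ℝ → ℝ} (hf : Integrable f) (x : ℝ) :
    Dinv f x = (∫ y in (0 : ℝ)..x, f y) + Dinv f 0 := by
  have h1 : ∀ z : ℝ, (∫ y in Set.Ioi z, f y) = (∫ y, f y) - ∫ y in Set.Iic z, f y := by
    intro z
    have := intervalIntegral.integral_Iic_add_Ioi (b := z) hf.integrableOn hf.integrableOn
    linarith
  have h2 := intervalIntegral.integral_Iic_sub_Iic (a := 0) (b := x)
    (μ := volume) hf.integrableOn hf.integrableOn
  simp only [Dinv, h1]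
  linarith

theorem hasDerivAt_Dinv (f : 𝓢(ℝ, ℝ)) (x : ℝ) : HasDerivAt (Dinv f) (f x) x := by
  have h : Dinv f = fun x => (∫ y in (0 : ℝ)..x, f y) + Dinv f 0 := by
    funext x
    exact Dinv_eq f.integrable x
  rw [h]
  exact (intervalIntegral.integral_hasDerivAt_right
    (f.continuous.intervalIntegrable _ _)
    (f.continuous.stronglyMeasurableAtFilter _ _) f.continuous.continuousAt).add_const _

theorem norm_Dinv_le (f : 𝓢(ℝ, ℝ)) (x : ℝ) : ‖Dinv f x‖ ≤ ∫ y, ‖f y‖ := by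
  have hf : Integrable (fun y => ‖f y‖) := f.integrable.norm
  have h1 : ‖∫ y in Set.Iic x, f y‖ ≤ ∫ y, ‖f y‖ :=
    (norm_integral_le_integral_norm _).trans
      (setIntegral_le_integral hf (Filter.Eventually.of_forall fun _ => norm_nonneg _))
  have h2 : ‖∫ y in Set.Ioi x, f y‖ ≤ ∫ y, ‖f y‖ :=
    (norm_integral_le_integral_norm _).trans
      (setIntegral_le_integral hf (Filter.Eventually.of_forall fun _ => norm_nonneg _))
  have h3 := norm_sub_le (∫ y in Set.Iic x, f y) (∫ y in Set.Ioi x, f y)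
  have h4 : ‖Dinv f x‖ = ‖(∫ y in Set.Iic x, f y) - ∫ y in Set.Ioi x, f y‖ / 2 := by
    simp [Dinv]
  linarith

theorem hasTemperateGrowth_Dinv (f : 𝓢(ℝ, ℝ)) : Function.HasTemperateGrowth (Dinv f) := by
  have hfd : fderiv ℝ (Dinv f) = fun x => ContinuousLinearMap.toSpanSingletonCLE (𝕜 := ℝ) (f x) := by
    funext x
    ext
    simp [(hasDerivAt_Dinv f x).deriv]
  refine Function.HasTemperateGrowth.of_fderiv (k := 0) (C := ∫ y, ‖f y‖) ?_
    (fun x => (hasDerivAt_Dinv f x).differentiableAt) ?_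
  · rw [hfd]
    exact (ContinuousLinearMap.toSpanSingletonCLE (𝕜 := ℝ) (E := ℝ)).hasTemperateGrowth.comp
      f.hasTemperateGrowth
  · intro x
    simpa using norm_Dinv_le f x

/-! ### The operators -/

/-- The rapidly decreasing function `Im (u w̄)`. -/
noncomputable def imMulConj (u w : Phase) : 𝓢(ℝ, ℝ) :=
  SchwartzMap.postcompCLM (𝕜 := ℝ) Complex.imCLM
    (SchwartzMap.pairing (ContinuousLinearMap.mul ℝ ℂ) u
      (SchwartzMap.postcompCLM (𝕜 := ℝ) Complex.conjCLE.toContinuousLinearMap w))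

@[simp]
theorem imMulConj_apply (u w : Phase) (x : ℝ) :
    imMulConj u w x = (u x * conj (w x)).im := by
  simp [imMulConj]

/-- `H = D_x - i u D_x⁻¹ Im (u C)`, with `C` the complex conjugation. -/
noncomputable def opH : OpField := fun u =>
  { toFun := fun w => SchwartzMap.derivCLM ℝ ℂ w -
      Complex.I • SchwartzMap.smulLeftCLM ℂ (Dinv (imMulConj u w)) u
    map_add' := by
      intro w z
      have h : (imMulConj u (w + z) : ℝ → ℝ) = imMulConj u w + imMulConj u z := by
        funext x
        simp [mul_add]
      rw [h, Dinv_add (imMulConj u w).integrable (imMulConj u z).integrable,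
        SchwartzMap.smulLeftCLM_add (hasTemperateGrowth_Dinv _) (hasTemperateGrowth_Dinv _)]
      simp only [map_add, add_apply, smul_add]
      abel
    map_smul' := by
      intro c w
      have h : (imMulConj u (c • w) : ℝ → ℝ) = c • ⇑(imMulConj u w) := by
        funext x
        simp [imMulConj_apply, -Complex.mul_im]
        simp
        ring
      rw [h, Dinv_smul, SchwartzMap.smulLeftCLM_smul (hasTemperateGrowth_Dinv _)]
      simp only [map_smul, smul_apply, smul_sub, RingHom.id_apply]
      rw [smul_comm] }

theorem opH_apply (u w : Phase) (x : ℝ) :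
    opH u w x = deriv w x -
      Complex.I * u x * (Dinv (fun y => (u y * conj (w y)).im) x : ℂ) := by
  have h : (imMulConj u w : ℝ → ℝ) = fun y => (u y * conj (w y)).im := by
    funext y
    exact imMulConj_apply u w y
  change SchwartzMap.derivCLM ℝ ℂ w x -
    Complex.I • SchwartzMap.smulLeftCLM ℂ (Dinv (imMulConj u w)) u x = _
  rw [SchwartzMap.smulLeftCLM_apply_apply (hasTemperateGrowth_Dinv _), h]
  simp
  ring

/-- Multiplication by `-i`, as an invertible real-linear map. -/
noncomputable def mulNegI : Phase ≃ₗ[ℝ] Phase :=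
  (LinearEquiv.smulOfNeZero ℂ Phase (-Complex.I) (neg_ne_zero.mpr Complex.I_ne_zero)).restrictScalars ℝ

/-- `I = -i`. -/
noncomputable def opI : OpField := fun _ => mulNegI.toLinearMap

/-- `I⁻¹`. -/
noncomputable def opIinv : OpField := fun _ => mulNegI.symm.toLinearMap

/-- `R = H I⁻¹`. -/
noncomputable def opR : OpField := fun u => opH u ∘ₗ opIinv u

/-- `R* = I⁻¹ H`. -/
noncomputable def opRstar : OpField := fun u => opIinv u ∘ₗ opH u

/-- `E = R H`. -/
noncomputable def opE : OpField := fun u => opR u ∘ₗ opH u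

/-- Invariance under phase rotations: `e^{iλ} D e^{-iλ} = D|_{u → e^{iλ} u}`. -/
def IsU1Invariant (D : OpField) : Prop :=
  ∀ (l : ℝ) (u w : Phase),
    Complex.exp (Complex.I * l) • D u (Complex.exp (-(Complex.I * l)) • w) =
      D (Complex.exp (Complex.I * l) • u) w

/-! ### Functionals and Poisson brackets -/

/-- The real pairing `∫ Re (P̄ v) dx` of covectors and flow vectors. -/
noncomputable def pair (P v : Phase) : ℝ := ∫ x, (conj (P x) * v x).re

/-- `d` is the derivative of `Φ` at `u` in the direction `v`: the limit of the difference
quotients `(Φ(u + t v) - Φ(u)) / t` as `t → 0`. -/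
def HasDirDeriv {V : Type*} [AddCommGroup V] [Module ℝ V] [TopologicalSpace V]
    (Φ : Phase → V) (u v : Phase) (d : V) : Prop :=
  Filter.Tendsto (fun t : ℝ => t⁻¹ • (Φ (u + t • v) - Φ u)) (𝓝[≠] 0) (𝓝 d)

/-- `P u` is the variational derivative `δF/δū` at every `u`, that is,
`δF = ∫ (δF/δu) δu + (δF/δū) δū dx = 2 ∫ Re (P̄ δu) dx`, where `δF/δu = P̄` as `F` is real. -/
def HasVarDeriv (F : Phase → ℝ) (P : Phase → Phase) : Prop :=
  ∀ u v : Phase, HasDirDeriv F u v (2 * pair (P u) v)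

open Classical in
/-- The variational derivative `δF/δū` (zero for functionals that have none). -/
noncomputable def varDeriv (F : Phase → ℝ) : Phase → Phase :=
  if h : ∃ P, HasVarDeriv F P then h.choose else 0

/-- Continuous differentiability on the Fréchet space `Phase`: the directional derivatives exist
and are jointly continuous in the point and the direction. -/
def IsC1 (Φ : Phase → Phase) : Prop :=
  ∃ Φ' : Phase → Phase → Phase, (∀ u v, HasDirDeriv Φ u v (Φ' u v)) ∧
    Continuous (fun p : Phase × Phase => Φ' p.1 p.2)

/-- The real-valued functionals: those that have a continuously differentiable variational
derivative. Among them are the integrals of real densities that are polynomial in `u`, `ū` and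
their `x`-derivatives, with terms of degree at least two whose coefficients are smooth functions of
`x` of temperate growth (or linear terms with rapidly decreasing coefficients). -/
def IsFunctional (F : Phase → ℝ) : Prop :=
  ∃ P : Phase → Phase, HasVarDeriv F P ∧ IsC1 P

/-- The bracket `{F, G} = ∫ Re (D(δF/δū) δG/δu) dx`. -/
noncomputable def bracket (D : OpField) (F G : Phase → ℝ) (u : Phase) : ℝ :=
  ∫ x, (D u (varDeriv F u) x * conj (varDeriv G u x)).re

/-- `D` is Hamiltonian: its bracket is skew-symmetric and satisfies the Jacobi identity. That
brackets have variational derivatives, so that they can be nested, is part of the claim. -/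
structure IsHamiltonian (D : OpField) : Prop where
  exists_varDeriv : ∀ F G, IsFunctional F → IsFunctional G →
    ∃ P, HasVarDeriv (bracket D F G) P
  skew : ∀ F G, IsFunctional F → IsFunctional G → ∀ u, bracket D F G u = -bracket D G F u
  jacobi : ∀ F G K, IsFunctional F → IsFunctional G → IsFunctional K → ∀ u,
    bracket D F (bracket D K G) u + bracket D K (bracket D G F) u +
      bracket D G (bracket D F K) u = 0

/-! ### Hereditary recursion operators -/

/-- `R' u v w` is the derivative `R'_u[v] w` of `u ↦ R_u w` in the direction `v`. -/
def HasVariation (R : OpField) (R' : Phase → Phase → Phase → Phase) : Prop :=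
  ∀ u v w, HasDirDeriv (fun z => R z w) u v (R' u v w)

/-- An operator `R` on flow vectors is hereditary: `R'[R v] w - R R'[v] w` is symmetric in `v`
and `w`. -/
def IsHereditary (R : OpField) : Prop :=
  ∃ R', HasVariation R R' ∧ ∀ u v w,
    R' u (R u v) w - R u (R' u v w) = R' u (R u w) v - R u (R' u w v)

/-- `R` is a recursion operator of the evolution equation `u_t = K(u)`:
`R'[K] = K' R - R K'`, so that `R` takes symmetries to symmetries. -/
def IsRecursionFor (R : OpField) (K : Phase → Phase) : Prop :=
  ∃ (R' : Phase → Phase → Phase → Phase) (K' : Phase → Phase → Phase), HasVariation R R' ∧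
    (∀ u v, HasDirDeriv K u v (K' u v)) ∧
    ∀ u w, R' u (K u) w = K' u (R u w) - R u (K' u w)

/-- `S` is the adjoint of `R`: it acts on covectors, and `⟨P, R v⟩ = ⟨S P, v⟩`. -/
def IsAdjointOf (S R : OpField) : Prop :=
  ∀ u P v, pair P (R u v) = pair (S u P) v

/-- An operator `S` on covectors, with adjoint `R` on flow vectors, is hereditary:
`⟨S'[R v] P, w⟩ - ⟨S'[v] S P, w⟩` is symmetric in `v` and `w`. -/
def IsCoHereditary (S : OpField) : Prop :=
  ∃ R S', IsAdjointOf S R ∧ HasVariation S S' ∧ ∀ u P v w,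
    pair (S' u (R u v) P) w - pair (S' u v (S u P)) w =
      pair (S' u (R u w) P) v - pair (S' u w (S u P)) v

/-- The recursion property for an operator `S` on covectors with adjoint `R`:
`⟨S'[K] P, w⟩ = ⟨P, K' R w⟩ - ⟨S P, K' w⟩`, that is, `S'[K] = S K'* - K'* S`. -/
def IsCoRecursionFor (S : OpField) (K : Phase → Phase) : Prop :=
  ∃ (R : OpField) (S' : Phase → Phase → Phase → Phase) (K' : Phase → Phase → Phase),
    IsAdjointOf S R ∧ HasVariation S S' ∧ (∀ u v, HasDirDeriv K u v (K' u v)) ∧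
    ∀ u P w, pair (S' u (K u) P) w = pair P (K' u (R u w)) - pair (S u P) (K' u w)

/-- `K` is the right-hand side of a bi-Hamiltonian evolution equation
`u_t = D₁(δF/δū) = D₂(δG/δū)`. -/
def IsBiHamiltonianFlow (D₁ D₂ : OpField) (K : Phase → Phase) : Prop :=
  ∃ F G, IsFunctional F ∧ IsFunctional G ∧
    (∀ u, K u = D₁ u (varDeriv F u)) ∧ (∀ u, K u = D₂ u (varDeriv G u))

end HasimotoFlow

/-! Second variations of functionals are symmetric, because variational derivatives are continuously
differentiable. For a skew operator `D` whose derivative `D'` can be transposed onto the direction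
of variation, the Hessian terms in the Jacobi identity therefore cancel. What remains is the
trilinear condition that `⟨r, D'[D p] q⟩` has cyclic sum zero in `p, q, r`
(`isHamiltonian_of_jacobi`).

Put `S = R* = I⁻¹ H` and `B(p, q, r) = ⟨r, H'[I p] q⟩` (`formH`). Two identities carry the analysis.
The cyclic sum of `B(p, q, r)` vanishes because its integrand is zero pointwise (`formH_cyclic`);
this is the compatibility of `H` and `I`. The cyclic sum of `B(S p, q, r)` vanishes because its
integrand is an exact `x`-derivative (`formH_opRstar_cyclic`); this is the Jacobi condition for `H`.

The rest is mostly algebra. Since `a E + b H + c I = I (a S² + b S + c)`, the Jacobi condition for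
the whole triple is a linear combination of the two identities evaluated at arguments hit by `S`.
The hereditary property is their difference, and the recursion property combines the second identity
with the symmetry of the second variations of both functionals. Since the phase space is only
Fréchet, all derivatives are taken along curves, where the product rule needs just the joint
continuity of the multilinear, partly nonlocal, expressions involved. -/

namespace HasimotoFlow

open Filter

/-! ### Continuity of products and of the nonlocal terms in the Schwartz topology -/

section Continuity

variable {E F G : Type*} [NormedAddCommGroup E] [NormedSpace ℝ E] [NormedAddCommGroup F]
  [NormedSpace ℝ F] [NormedAddCommGroup G] [NormedSpace ℝ G]

theorem seminorm_succ_le_deriv (k n : ℕ) (f : 𝓢(ℝ, F)) :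
    SchwartzMap.seminorm ℝ k (n + 1) f ≤
      SchwartzMap.seminorm ℝ k n (SchwartzMap.derivCLM ℝ F f) := by
  refine SchwartzMap.seminorm_le_bound' ℝ k (n + 1) f (apply_nonneg _ _) fun x => ?_
  have h := SchwartzMap.le_seminorm' ℝ k n (SchwartzMap.derivCLM ℝ F f) x
  have hd : (SchwartzMap.derivCLM ℝ F f : ℝ → F) = deriv f := by
    funext y
    exact SchwartzMap.derivCLM_apply ℝ f y
  rwa [hd, ← iteratedDeriv_succ'] at h

theorem tendsto_schwartz_iff {ι : Type*} {l : Filter ι} {f : ι → 𝓢(ℝ, F)} {g : 𝓢(ℝ, F)} :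
    Tendsto f l (𝓝 g) ↔
      ∀ n k, Tendsto (fun i => SchwartzMap.seminorm ℝ k n (f i - g)) l (𝓝 0) := by
  rw [(schwartz_withSeminorms ℝ ℝ F).tendsto_nhds]
  constructor
  · intro h n k
    rw [Metric.tendsto_nhds]
    intro ε hε
    filter_upwards [h (k, n) ε hε] with i hi
    rw [Real.dist_eq, sub_zero, abs_of_nonneg (apply_nonneg _ _)]
    exact hi
  · rintro h ⟨k, n⟩ ε hε
    exact (h n k).eventually_lt_const hε

theorem tendsto_seminorm {ι : Type*} {l : Filter ι} {f : ι → 𝓢(ℝ, F)} {g : 𝓢(ℝ, F)}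
    (h : Tendsto f l (𝓝 g)) (k n : ℕ) :
    Tendsto (fun i => SchwartzMap.seminorm ℝ k n (f i)) l (𝓝 (SchwartzMap.seminorm ℝ k n g)) :=
  (((schwartz_withSeminorms ℝ ℝ F).continuous_seminorm (k, n)).tendsto g).comp h

theorem tendsto_seminorm_zero_of_le {ι : Type*} {l : Filter ι} {f : ι → 𝓢(ℝ, F)} {k n : ℕ}
    {b : ι → ℝ} (hb : Tendsto b l (𝓝 0)) (h : ∀ i, SchwartzMap.seminorm ℝ k n (f i) ≤ b i) :
    Tendsto (fun i => SchwartzMap.seminorm ℝ k n (f i)) l (𝓝 0) :=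
  squeeze_zero (fun _ => apply_nonneg _ _) h hb

theorem seminorm_pairing_le (B : E →L[ℝ] F →L[ℝ] G) (k : ℕ) (f : 𝓢(ℝ, E)) (g : 𝓢(ℝ, F)) :
    SchwartzMap.seminorm ℝ k 0 (SchwartzMap.pairing B f g) ≤
      ‖B‖ * SchwartzMap.seminorm ℝ k 0 f * SchwartzMap.seminorm ℝ 0 0 g := by
  refine SchwartzMap.seminorm_le_bound' ℝ k 0 _ (by positivity) fun x => ?_
  have h1 := SchwartzMap.norm_pow_mul_le_seminorm ℝ f k x
  have h2 := SchwartzMap.norm_le_seminorm ℝ g x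
  rw [Real.norm_eq_abs] at h1
  rw [iteratedDeriv_zero, SchwartzMap.pairing_apply_apply]
  calc |x| ^ k * ‖B (f x) (g x)‖ ≤ |x| ^ k * (‖B‖ * ‖f x‖ * ‖g x‖) := by
        gcongr
        exact B.le_opNorm₂ _ _
    _ = ‖B‖ * (|x| ^ k * ‖f x‖) * ‖g x‖ := by ring
    _ ≤ _ := by gcongr

theorem derivCLM_pairing (B : E →L[ℝ] F →L[ℝ] G) (f : 𝓢(ℝ, E)) (g : 𝓢(ℝ, F)) :
    SchwartzMap.derivCLM ℝ G (SchwartzMap.pairing B f g) =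
      SchwartzMap.pairing B (SchwartzMap.derivCLM ℝ E f) g +
        SchwartzMap.pairing B f (SchwartzMap.derivCLM ℝ F g) := by
  ext x
  have h := B.hasDerivAt_of_bilinear (fun _ => f.hasDerivAt x) (fun _ => g.hasDerivAt x)
  rw [SchwartzMap.derivCLM_apply]
  refine Eq.trans h.deriv ?_
  simp [add_comm]

/-- Induction on the number of derivatives, with the sequences and the weight `k` left free: order
zero is a direct sup estimate, and the Leibniz rule reduces order `n + 1` to two pairings at order
`n`. -/
theorem tendsto_pairing (B : E →L[ℝ] F →L[ℝ] G) {ι : Type*} {l : Filter ι}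
    {f : ι → 𝓢(ℝ, E)} {f₀ : 𝓢(ℝ, E)} {g : ι → 𝓢(ℝ, F)} {g₀ : 𝓢(ℝ, F)}
    (hf : Tendsto f l (𝓝 f₀)) (hg : Tendsto g l (𝓝 g₀)) :
    Tendsto (fun i => SchwartzMap.pairing B (f i) (g i)) l
      (𝓝 (SchwartzMap.pairing B f₀ g₀)) := by
  rw [tendsto_schwartz_iff]
  intro n
  induction n generalizing f f₀ g g₀ with
  | zero =>
    intro k
    have h1 := tendsto_schwartz_iff.1 hf 0 k
    have h2 := tendsto_schwartz_iff.1 hg 0 0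
    have h3 := ((h1.const_mul ‖B‖).mul (tendsto_seminorm hg 0 0)).add
      (h2.const_mul (‖B‖ * SchwartzMap.seminorm ℝ k 0 f₀))
    simp only [mul_zero, zero_mul, add_zero] at h3
    refine tendsto_seminorm_zero_of_le h3 fun i => ?_
    have h4 : SchwartzMap.pairing B (f i) (g i) - SchwartzMap.pairing B f₀ g₀ =
        SchwartzMap.pairing B (f i - f₀) (g i) + SchwartzMap.pairing B f₀ (g i - g₀) := by
      ext x
      simp
    rw [h4]
    exact (map_add_le_add _ _ _).trans
      (add_le_add (seminorm_pairing_le B k _ _) (seminorm_pairing_le B k _ _))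
  | succ n ih =>
    intro k
    have hf' := ((SchwartzMap.derivCLM ℝ E).continuous.tendsto f₀).comp hf
    have hg' := ((SchwartzMap.derivCLM ℝ F).continuous.tendsto g₀).comp hg
    have h3 := (ih hf' hg k).add (ih hf hg' k)
    rw [add_zero] at h3
    refine tendsto_seminorm_zero_of_le h3 fun i => ?_
    refine (seminorm_succ_le_deriv k n _).trans ?_
    rw [map_sub, derivCLM_pairing, derivCLM_pairing, add_sub_add_comm]
    exact map_add_le_add _ _ _

/-- The rapidly decreasing function `(D_x⁻¹ f) u`. -/
noncomputable def DinvMul (f : 𝓢(ℝ, ℝ)) (u : Phase) : Phase :=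
  SchwartzMap.smulLeftCLM ℂ (Dinv f) u

@[simp]
theorem DinvMul_apply (f : 𝓢(ℝ, ℝ)) (u : Phase) (x : ℝ) :
    DinvMul f u x = (Dinv f x : ℂ) * u x := by
  simp [DinvMul, SchwartzMap.smulLeftCLM_apply_apply (hasTemperateGrowth_Dinv _)]

@[simp]
theorem Dinv_add_apply (f g : 𝓢(ℝ, ℝ)) (x : ℝ) : Dinv (⇑f + ⇑g) x = Dinv f x + Dinv g x :=
  congrFun (Dinv_add f.integrable g.integrable) x

@[simp]
theorem Dinv_smul_apply (c : ℝ) (f : 𝓢(ℝ, ℝ)) (x : ℝ) : Dinv (c • ⇑f) x = c * Dinv f x :=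
  congrFun (Dinv_smul c f) x

@[simp]
theorem Dinv_neg_apply (f : 𝓢(ℝ, ℝ)) (x : ℝ) : Dinv (-⇑f) x = -Dinv f x := by
  have h := Dinv_smul_apply (-1) f x
  rwa [neg_one_smul, neg_one_mul] at h

@[simp]
theorem Dinv_sub_apply (f g : 𝓢(ℝ, ℝ)) (x : ℝ) : Dinv (⇑f - ⇑g) x = Dinv f x - Dinv g x := by
  have h := Dinv_add_apply f (-g) x
  have hg : ⇑(-g) = -⇑g := rfl
  rw [hg, Dinv_neg_apply] at h
  rw [sub_eq_add_neg ⇑f, h, ← sub_eq_add_neg]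

/-- `D_x⁻¹ f` is bounded by the `L¹` norm of `f` but need not decay, so all the weight has to fall
on `u`. -/
theorem seminorm_DinvMul_le (k : ℕ) (f : 𝓢(ℝ, ℝ)) (u : Phase) :
    SchwartzMap.seminorm ℝ k 0 (DinvMul f u) ≤ (∫ y, ‖f y‖) * SchwartzMap.seminorm ℝ k 0 u := by
  have h0 : 0 ≤ ∫ y, ‖f y‖ := integral_nonneg fun _ => norm_nonneg _
  refine SchwartzMap.seminorm_le_bound' ℝ k 0 _ (by positivity) fun x => ?_
  have h1 := SchwartzMap.norm_pow_mul_le_seminorm ℝ u k x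
  have h2 := norm_Dinv_le f x
  rw [Real.norm_eq_abs] at h1
  rw [iteratedDeriv_zero, DinvMul_apply, norm_mul, Complex.norm_real]
  calc |x| ^ k * (‖Dinv f x‖ * ‖u x‖) = ‖Dinv f x‖ * (|x| ^ k * ‖u x‖) := by ring
    _ ≤ _ := by gcongr

theorem derivCLM_DinvMul (f : 𝓢(ℝ, ℝ)) (u : Phase) :
    SchwartzMap.derivCLM ℝ ℂ (DinvMul f u) =
      SchwartzMap.pairing (ContinuousLinearMap.lsmul ℝ ℝ) f u +
        DinvMul f (SchwartzMap.derivCLM ℝ ℂ u) := by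
  ext x
  have h := ((hasDerivAt_Dinv f x).ofReal_comp).mul (u.hasDerivAt x)
  have h' : (DinvMul f u : ℝ → ℂ) = (fun y => (Dinv f y : ℂ)) * u := by
    funext y
    simp
  rw [SchwartzMap.derivCLM_apply, h', h.deriv]
  simp

theorem tendsto_integral_norm {ι : Type*} {l : Filter ι} {f : ι → 𝓢(ℝ, F)} {f₀ : 𝓢(ℝ, F)}
    (hf : Tendsto f l (𝓝 f₀)) :
    Tendsto (fun i => ∫ y, ‖f i y‖) l (𝓝 (∫ y, ‖f₀ y‖)) := by
  have h : ∀ g : 𝓢(ℝ, F), ∫ y, ‖g y‖ = ‖g.toLp 1 volume‖ := by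
    intro g
    rw [SchwartzMap.norm_toLp_one]
  simp only [h]
  exact ((SchwartzMap.continuous_toLp (p := 1) (μ := volume)).tendsto f₀).comp hf |>.norm

/-- The same induction as for local products. Differentiating `D_x⁻¹ f` leaves the local product `f
g`, so the nonlocal factor is only ever estimated at order zero. -/
theorem tendsto_DinvMul {ι : Type*} {l : Filter ι}
    {f : ι → 𝓢(ℝ, ℝ)} {f₀ : 𝓢(ℝ, ℝ)} {g : ι → Phase} {g₀ : Phase}
    (hf : Tendsto f l (𝓝 f₀)) (hg : Tendsto g l (𝓝 g₀)) :
    Tendsto (fun i => DinvMul (f i) (g i)) l (𝓝 (DinvMul f₀ g₀)) := by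
  rw [tendsto_schwartz_iff]
  intro n
  induction n generalizing f f₀ g g₀ with
  | zero =>
    intro k
    have h1 : Tendsto (fun i => ∫ y, ‖(f i - f₀) y‖) l (𝓝 0) := by
      simpa using tendsto_integral_norm (hf.sub_const f₀)
    have h2 := tendsto_schwartz_iff.1 hg 0 k
    have h3 := (h1.mul (tendsto_seminorm hg k 0)).add (h2.const_mul (∫ y, ‖f₀ y‖))
    simp only [mul_zero, zero_mul, add_zero] at h3
    refine tendsto_seminorm_zero_of_le h3 fun i => ?_
    have h4 : DinvMul (f i) (g i) - DinvMul f₀ g₀ =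
        DinvMul (f i - f₀) (g i) + DinvMul f₀ (g i - g₀) := by
      ext x
      simp
      ring
    rw [h4]
    exact (map_add_le_add _ _ _).trans
      (add_le_add (seminorm_DinvMul_le k _ _) (seminorm_DinvMul_le k _ _))
  | succ n ih =>
    intro k
    have hg' := ((SchwartzMap.derivCLM ℝ ℂ).continuous.tendsto g₀).comp hg
    have h3 := (tendsto_schwartz_iff.1
      (tendsto_pairing (ContinuousLinearMap.lsmul ℝ ℝ) hf hg) n k).add (ih hf hg' k)
    rw [add_zero] at h3
    refine tendsto_seminorm_zero_of_le h3 fun i => ?_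
    refine (seminorm_succ_le_deriv k n _).trans ?_
    rw [map_sub, derivCLM_DinvMul, derivCLM_DinvMul, add_sub_add_comm]
    exact map_add_le_add _ _ _

theorem tendsto_imMulConj {ι : Type*} {l : Filter ι}
    {f : ι → Phase} {f₀ : Phase} {g : ι → Phase} {g₀ : Phase}
    (hf : Tendsto f l (𝓝 f₀)) (hg : Tendsto g l (𝓝 g₀)) :
    Tendsto (fun i => imMulConj (f i) (g i)) l (𝓝 (imMulConj f₀ g₀)) :=
  ((SchwartzMap.postcompCLM (𝕜 := ℝ) Complex.imCLM).continuous.tendsto _).comp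
    (tendsto_pairing (ContinuousLinearMap.mul ℝ ℂ) hf
      (((SchwartzMap.postcompCLM (𝕜 := ℝ) Complex.conjCLE.toContinuousLinearMap).continuous.tendsto
        _).comp hg))

/-- `D_x⁻¹ (Im (v w̄)) u`. -/
noncomputable def opT (u v w : Phase) : Phase := DinvMul (imMulConj v w) u

@[simp]
theorem opT_apply (u v w : Phase) (x : ℝ) :
    opT u v w x = (Dinv (imMulConj v w) x : ℂ) * u x := by
  simp [opT]

theorem tendsto_opT {ι : Type*} {l : Filter ι} {f g h : ι → Phase} {f₀ g₀ h₀ : Phase}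
    (hf : Tendsto f l (𝓝 f₀)) (hg : Tendsto g l (𝓝 g₀)) (hh : Tendsto h l (𝓝 h₀)) :
    Tendsto (fun i => opT (f i) (g i) (h i)) l (𝓝 (opT f₀ g₀ h₀)) :=
  tendsto_DinvMul (tendsto_imMulConj hg hh) hf

/-- The rapidly decreasing function `Re (P̄ v)`. -/
noncomputable def reConjMul (P v : Phase) : 𝓢(ℝ, ℝ) :=
  SchwartzMap.postcompCLM (𝕜 := ℝ) Complex.reCLM
    (SchwartzMap.pairing (ContinuousLinearMap.mul ℝ ℂ)
      (SchwartzMap.postcompCLM (𝕜 := ℝ) Complex.conjCLE.toContinuousLinearMap P) v)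

@[simp]
theorem reConjMul_apply (P v : Phase) (x : ℝ) : reConjMul P v x = (conj (P x) * v x).re := by
  simp [reConjMul]

theorem pair_eq_integral (P v : Phase) : pair P v = ∫ x, reConjMul P v x := by
  simp only [pair, reConjMul_apply]

theorem tendsto_pair {ι : Type*} {l : Filter ι}
    {f : ι → Phase} {f₀ : Phase} {g : ι → Phase} {g₀ : Phase}
    (hf : Tendsto f l (𝓝 f₀)) (hg : Tendsto g l (𝓝 g₀)) :
    Tendsto (fun i => pair (f i) (g i)) l (𝓝 (pair f₀ g₀)) := by
  simp only [pair_eq_integral]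
  exact ((SchwartzMap.integralCLM ℝ (volume : Measure ℝ)).continuous.tendsto _).comp
    (((SchwartzMap.postcompCLM (𝕜 := ℝ) Complex.reCLM).continuous.tendsto _).comp
      (tendsto_pairing (ContinuousLinearMap.mul ℝ ℂ)
        (((SchwartzMap.postcompCLM (𝕜 := ℝ)
          Complex.conjCLE.toContinuousLinearMap).continuous.tendsto _).comp hf) hg))

end Continuity

/-! ### The pairing -/

theorem reConjMul_add_right (P v w : Phase) :
    reConjMul P (v + w) = reConjMul P v + reConjMul P w := by
  ext x
  simp [-Complex.mul_re, mul_add]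

theorem reConjMul_smul_right (c : ℝ) (P v : Phase) :
    reConjMul P (c • v) = c • reConjMul P v := by
  ext x
  simp
  ring

theorem pair_comm (P v : Phase) : pair P v = pair v P := by
  refine integral_congr_ae (Eventually.of_forall fun x => ?_)
  simp
  ring

theorem pair_add_right (P v w : Phase) : pair P (v + w) = pair P v + pair P w := by
  simp only [pair_eq_integral, reConjMul_add_right]
  exact map_add (SchwartzMap.integralCLM ℝ (volume : Measure ℝ)) _ _

theorem pair_smul_right (c : ℝ) (P v : Phase) : pair P (c • v) = c * pair P v := by
  simp only [pair_eq_integral, reConjMul_smul_right]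
  exact map_smul (SchwartzMap.integralCLM ℝ (volume : Measure ℝ)) c _

theorem pair_neg_right (P v : Phase) : pair P (-v) = -pair P v := by
  simpa using pair_smul_right (-1) P v

theorem pair_sub_right (P v w : Phase) : pair P (v - w) = pair P v - pair P w := by
  rw [sub_eq_add_neg, pair_add_right, pair_neg_right, sub_eq_add_neg]

theorem pair_add_left (P Q v : Phase) : pair (P + Q) v = pair P v + pair Q v := by
  simp only [pair_comm _ v, pair_add_right]

theorem pair_smul_left (c : ℝ) (P v : Phase) : pair (c • P) v = c * pair P v := by
  simp only [pair_comm _ v, pair_smul_right]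

theorem pair_neg_left (P v : Phase) : pair (-P) v = -pair P v := by
  simp only [pair_comm _ v, pair_neg_right]

theorem pair_sub_left (P Q v : Phase) : pair (P - Q) v = pair P v - pair Q v := by
  simp only [pair_comm _ v, pair_sub_right]

theorem pair_I_smul_right (P v : Phase) : pair P (Complex.I • v) = -pair (Complex.I • P) v := by
  unfold pair
  rw [← integral_neg]
  refine integral_congr_ae (Eventually.of_forall fun x => ?_)
  simp
  ring

theorem eq_zero_of_pair_self {P : Phase} (h : pair P P = 0) : P = 0 := by
  rw [pair_eq_integral, integral_eq_zero_iff_of_nonneg _ (reConjMul P P).integrable] at h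
  · have h' := (Continuous.ae_eq_iff_eq volume (reConjMul P P).continuous continuous_zero).1 h
    ext x
    have hx := congrFun h' x
    simp only [reConjMul_apply, Complex.conj_mul', Pi.zero_apply] at hx
    norm_cast at hx
    simpa using hx
  · intro x
    simp only [reConjMul_apply, Complex.conj_mul', Pi.zero_apply]
    norm_cast
    positivity

theorem eq_of_forall_pair_left {P Q : Phase} (h : ∀ v, pair P v = pair Q v) : P = Q := by
  refine sub_eq_zero.1 (eq_zero_of_pair_self ?_)
  rw [pair_sub_left, h, sub_self]

theorem eq_of_forall_pair_right {v w : Phase} (h : ∀ P, pair P v = pair P w) : v = w :=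
  eq_of_forall_pair_left fun P => by rw [pair_comm v, pair_comm w, h]

/-! ### Derivatives along curves -/

section Curve

variable {V W : Type*} [AddCommGroup V] [Module ℝ V] [TopologicalSpace V]
  [AddCommGroup W] [Module ℝ W] [TopologicalSpace W]

/-- `d` is the derivative at `0` of the curve `γ`. -/
def HasCurveDeriv (γ : ℝ → V) (d : V) : Prop :=
  Tendsto (fun t : ℝ => t⁻¹ • (γ t - γ 0)) (𝓝[≠] 0) (𝓝 d)

theorem hasDirDeriv_iff_hasCurveDeriv {Φ : Phase → V} {u v : Phase} {d : V} :
    HasDirDeriv Φ u v d ↔ HasCurveDeriv (fun t => Φ (u + t • v)) d := by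
  simp [HasDirDeriv, HasCurveDeriv]

theorem HasCurveDeriv.tendsto [IsTopologicalAddGroup V] [ContinuousSMul ℝ V] {γ : ℝ → V} {d : V}
    (h : HasCurveDeriv γ d) : Tendsto γ (𝓝[≠] 0) (𝓝 (γ 0)) := by
  have h1 : Tendsto (fun t : ℝ => t) (𝓝[≠] 0) (𝓝 0) := tendsto_nhdsWithin_of_tendsto_nhds tendsto_id
  have h2 := (h1.smul h).add_const (γ 0)
  rw [zero_smul, zero_add] at h2
  refine h2.congr' ?_
  filter_upwards [self_mem_nhdsWithin] with t ht
  rw [smul_inv_smul₀ ht, sub_add_cancel]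

theorem hasCurveDeriv_line [IsTopologicalAddGroup V] (u v : V) :
    HasCurveDeriv (fun t : ℝ => u + t • v) v := by
  refine tendsto_const_nhds.congr' ?_
  filter_upwards [self_mem_nhdsWithin] with t ht
  simp [inv_smul_smul₀ ht]

theorem hasCurveDeriv_const (u : V) : HasCurveDeriv (fun _ : ℝ => u) 0 := by
  refine tendsto_const_nhds.congr' ?_
  simp

theorem HasCurveDeriv.add [IsTopologicalAddGroup V] {γ η : ℝ → V} {a b : V}
    (hγ : HasCurveDeriv γ a) (hη : HasCurveDeriv η b) :
    HasCurveDeriv (fun t => γ t + η t) (a + b) := by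
  refine (Tendsto.add hγ hη).congr fun t => ?_
  rw [← smul_add, add_sub_add_comm]

theorem HasCurveDeriv.map {γ : ℝ → V} {a : V} (hγ : HasCurveDeriv γ a) (L : V →L[ℝ] W) :
    HasCurveDeriv (fun t => L (γ t)) (L a) := by
  refine ((L.continuous.tendsto a).comp hγ).congr fun t => ?_
  simp

theorem HasCurveDeriv.unique [T2Space V] {γ : ℝ → V} {a b : V} (ha : HasCurveDeriv γ a)
    (hb : HasCurveDeriv γ b) : a = b :=
  tendsto_nhds_unique ha hb

end Curve

theorem HasCurveDeriv.const_smul {γ : ℝ → Phase} {a : Phase} (hγ : HasCurveDeriv γ a) (c : ℝ) :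
    HasCurveDeriv (fun t => c • γ t) (c • a) :=
  hγ.map (c • ContinuousLinearMap.id ℝ Phase)

/-- Multiplication by `i` as a continuous linear map. -/
noncomputable def mulICLM : Phase →L[ℝ] Phase where
  toFun w := Complex.I • w
  map_add' := smul_add _
  map_smul' c w := smul_comm _ c w
  cont := continuous_const_smul _

theorem HasCurveDeriv.I_smul {γ : ℝ → Phase} {a : Phase} (hγ : HasCurveDeriv γ a) :
    HasCurveDeriv (fun t => Complex.I • γ t) (Complex.I • a) :=
  hγ.map mulICLM

theorem HasCurveDeriv.pair {γ η : ℝ → Phase} {a b : Phase}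
    (hγ : HasCurveDeriv γ a) (hη : HasCurveDeriv η b) :
    HasCurveDeriv (fun t => pair (γ t) (η t)) (pair a (η 0) + pair (γ 0) b) := by
  refine ((tendsto_pair hγ hη.tendsto).add (tendsto_pair tendsto_const_nhds hη)).congr fun t => ?_
  simp only [pair_smul_left, pair_smul_right, pair_sub_left, pair_sub_right, smul_eq_mul]
  ring

/-! ### Symmetry of second variations -/

/-- Schwarz's argument: two applications of the mean value theorem turn the second difference
quotient into a value of the mixed derivative at a point of the square `(0, h)²`. Only one order of
differentiation is assumed. -/
theorem tendsto_second_difference {f fs fst : ℝ → ℝ → ℝ}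
    (hs : ∀ s t, HasDerivAt (fun s => f s t) (fs s t) s)
    (hst : ∀ s t, HasDerivAt (fun t => fs s t) (fst s t) t)
    (hc : Tendsto (fun p : ℝ × ℝ => fst p.1 p.2) (𝓝 (0, 0)) (𝓝 (fst 0 0))) :
    Tendsto (fun h : ℝ => (f h h - f h 0 - (f 0 h - f 0 0)) / h ^ 2) (𝓝[>] 0)
      (𝓝 (fst 0 0)) := by
  have key : ∀ h : ℝ, ∃ p : ℝ × ℝ, 0 < h → (p.1 ∈ Set.Ioo 0 h ∧ p.2 ∈ Set.Ioo 0 h ∧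
      fst p.1 p.2 = (f h h - f h 0 - (f 0 h - f 0 0)) / h ^ 2) := by
    intro h
    by_cases hh : 0 < h
    · have hd : ∀ s, HasDerivAt (fun s => f s h - f s 0) (fs s h - fs s 0) s :=
        fun s => (hs s h).sub (hs s 0)
      obtain ⟨σ, hσ, h1⟩ := exists_hasDerivAt_eq_slope (fun s => f s h - f s 0) _ hh
        (fun s _ => (hd s).continuousAt.continuousWithinAt) (fun s _ => hd s)
      obtain ⟨τ, hτ, h2⟩ := exists_hasDerivAt_eq_slope (fun t => fs σ t) _ hh
        (fun t _ => (hst σ t).continuousAt.continuousWithinAt) (fun t _ => hst σ t)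
      refine ⟨(σ, τ), fun _ => ⟨hσ, hτ, ?_⟩⟩
      rw [h2, h1, sub_zero, div_div, sq]
    · exact ⟨0, fun h' => absurd h' hh⟩
  choose p hp using key
  have hid : Tendsto (fun h : ℝ => h) (𝓝[>] 0) (𝓝 0) :=
    tendsto_nhdsWithin_of_tendsto_nhds tendsto_id
  have h1 : Tendsto (fun h => (p h).1) (𝓝[>] 0) (𝓝 0) := by
    refine tendsto_of_tendsto_of_tendsto_of_le_of_le' tendsto_const_nhds hid ?_ ?_ <;>
      filter_upwards [self_mem_nhdsWithin] with h hh
    · exact (hp h hh).1.1.le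
    · exact (hp h hh).1.2.le
  have h2 : Tendsto (fun h => (p h).2) (𝓝[>] 0) (𝓝 0) := by
    refine tendsto_of_tendsto_of_tendsto_of_le_of_le' tendsto_const_nhds hid ?_ ?_ <;>
      filter_upwards [self_mem_nhdsWithin] with h hh
    · exact (hp h hh).2.1.1.le
    · exact (hp h hh).2.1.2.le
  refine (hc.comp (h1.prodMk_nhds h2)).congr' ?_
  filter_upwards [self_mem_nhdsWithin] with h hh
  exact (hp h hh).2.2

theorem HasDirDeriv.hasDerivAt {Φ : Phase → ℝ} {γ : ℝ → Phase} {v : Phase} {d : ℝ} {s : ℝ}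
    (h : HasDirDeriv Φ (γ s) v d) (hγ : ∀ t, γ (s + t) = γ s + t • v) :
    HasDerivAt (fun s => Φ (γ s)) d s := by
  rw [hasDerivAt_iff_tendsto_slope_zero]
  simp only [hγ]
  exact h

theorem HasDirDeriv.pair_const {Φ : Phase → Phase} {u v d : Phase} (h : HasDirDeriv Φ u v d)
    (w : Phase) : HasDirDeriv (fun z => 2 * pair (Φ z) w) u v (2 * pair d w) := by
  refine ((tendsto_pair h tendsto_const_nhds).const_mul 2).congr fun t => ?_
  simp only [pair_smul_left, pair_sub_left, smul_eq_mul]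
  ring

theorem pair_secondVariation_comm {F : Phase → ℝ} {P : Phase → Phase} {P' : Phase → Phase → Phase}
    (hF : HasVarDeriv F P) (hP : ∀ u v, HasDirDeriv P u v (P' u v))
    (hc : Continuous (fun p : Phase × Phase => P' p.1 p.2)) (u v w : Phase) :
    pair (P' u v) w = pair (P' u w) v := by
  have hcont : ∀ v w z : Phase, Tendsto (fun p : ℝ × ℝ => 2 * pair (P' (u + p.1 • v + p.2 • w) z) v)
      (𝓝 (0, 0)) (𝓝 (2 * pair (P' (u + (0 : ℝ) • v + (0 : ℝ) • w) z) v)) := by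
    intro v w z
    have h1 : Continuous fun p : ℝ × ℝ => P' (u + p.1 • v + p.2 • w) z :=
      hc.comp (f := fun p : ℝ × ℝ => (u + p.1 • v + p.2 • w, z)) (by fun_prop)
    exact (tendsto_pair (h1.tendsto (0, 0)) tendsto_const_nhds).const_mul 2
  have key : ∀ v w : Phase, Tendsto (fun h : ℝ =>
      (F (u + h • v + h • w) - F (u + h • v + (0 : ℝ) • w) -
      (F (u + (0 : ℝ) • v + h • w) - F (u + (0 : ℝ) • v + (0 : ℝ) • w))) / h ^ 2) (𝓝[>] 0)
      (𝓝 (2 * pair (P' (u + (0 : ℝ) • v + (0 : ℝ) • w) w) v)) := by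
    intro v w
    refine tendsto_second_difference (f := fun s t => F (u + s • v + t • w))
      (fs := fun s t => 2 * pair (P (u + s • v + t • w)) v)
      (fst := fun s t => 2 * pair (P' (u + s • v + t • w) w) v) ?_ ?_ (hcont v w w)
    · intro s t
      exact HasDirDeriv.hasDerivAt (γ := fun s => u + s • v + t • w) (hF _ v)
        fun r => by module
    · intro s t
      exact HasDirDeriv.hasDerivAt (γ := fun t => u + s • v + t • w) ((hP _ w).pair_const v)
        fun r => by module
  have h1 := key v w
  have h2 := key w v
  -- The second difference is symmetric in `v` and `w`, so both mixed derivatives are limits of the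
  -- same quotient.
  have h3 := tendsto_nhds_unique h1 (h2.congr fun h => by
    rw [add_right_comm u (h • w) (h • v), add_right_comm u (h • w) ((0 : ℝ) • v),
      add_right_comm u ((0 : ℝ) • w) (h • v), add_right_comm u ((0 : ℝ) • w) ((0 : ℝ) • v)]
    ring)
  simp only [zero_smul, add_zero] at h3
  linarith

/-! ### Hamiltonian operators -/

/-- Nondegeneracy of the pairing makes the variational derivative unique, so the choice inside
`varDeriv` is harmless. -/
theorem HasVarDeriv.varDeriv_eq {F : Phase → ℝ} {P : Phase → Phase} (h : HasVarDeriv F P) :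
    varDeriv F = P := by
  have h' : ∃ P, HasVarDeriv F P := ⟨P, h⟩
  rw [varDeriv, dif_pos h']
  funext u
  refine eq_of_forall_pair_left fun v => ?_
  have h1 := tendsto_nhds_unique (h'.choose_spec u v) (h u v)
  linarith

theorem IsFunctional.exists_secondVariation {F : Phase → ℝ} (h : IsFunctional F) :
    HasVarDeriv F (varDeriv F) ∧ ∃ P' : Phase → Phase → Phase,
      (∀ u v, HasDirDeriv (varDeriv F) u v (P' u v)) ∧
        ∀ u v w, pair (P' u v) w = pair (P' u w) v := by
  obtain ⟨P, hP, P', hP', hc⟩ := h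
  rw [hP.varDeriv_eq]
  exact ⟨hP, P', hP', pair_secondVariation_comm hP hP' hc⟩

theorem bracket_eq_pair (D : OpField) (F G : Phase → ℝ) (u : Phase) :
    bracket D F G u = pair (varDeriv G u) (D u (varDeriv F u)) := by
  simp only [bracket, pair, mul_comm]

/-- `D'` is the derivative of `D` along curves: `(D_γ η)' = D'_γ[γ'] η + D_γ η'`. -/
def HasCurveVariation (D : OpField) (D' : Phase → Phase → Phase → Phase) : Prop :=
  ∀ (γ η : ℝ → Phase) (a b : Phase), HasCurveDeriv γ a → HasCurveDeriv η b →
    HasCurveDeriv (fun t => D (γ t) (η t)) (D' (γ 0) a (η 0) + D (γ 0) b)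

theorem HasCurveVariation.hasVariation {D : OpField} {D' : Phase → Phase → Phase → Phase}
    (h : HasCurveVariation D D') : HasVariation D D' := by
  intro u v w
  rw [hasDirDeriv_iff_hasCurveDeriv]
  simpa using h _ _ _ _ (hasCurveDeriv_line u v) (hasCurveDeriv_const w)

/-- The operator `D` is skew-symmetric. -/
def IsSkew (D : OpField) : Prop := ∀ u p q, pair q (D u p) = -pair p (D u q)

/-- The product rule gives the variational derivative of a bracket: two Hessian terms and the
transpose `M` of `D'`. In the nested brackets each Hessian occurs twice with opposite signs, leaving
half of the cyclic sum in `hJ`. -/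
theorem isHamiltonian_of_jacobi {D : OpField} {D' : Phase → Phase → Phase → Phase}
    (hskew : IsSkew D) (hD : HasCurveVariation D D')
    (hM : ∀ u q r, ∃ m, ∀ v, pair r (D' u v q) = pair m v)
    (hJ : ∀ u p q r, pair r (D' u (D u p) q) + pair p (D' u (D u q) r) +
      pair q (D' u (D u r) p) = 0) : IsHamiltonian D := by
  choose M hM using hM
  have key : ∀ (F G : Phase → ℝ) (P Q : Phase → Phase) (P' Q' : Phase → Phase → Phase),
      HasVarDeriv F P → HasVarDeriv G Q → (∀ u v, HasDirDeriv P u v (P' u v)) →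
      (∀ u v, HasDirDeriv Q u v (Q' u v)) → (∀ u v w, pair (P' u v) w = pair (P' u w) v) →
      (∀ u v w, pair (Q' u v) w = pair (Q' u w) v) →
      -- The factor `2⁻¹` compensates the `2` in the definition of the variational derivative.
      HasVarDeriv (bracket D F G) fun u => (2⁻¹ : ℝ) •
        (Q' u (D u (P u)) - P' u (D u (Q u)) + M u (P u) (Q u)) := by
    intro F G P Q P' Q' hF hG hP hQ hPs hQs u v
    rw [hasDirDeriv_iff_hasCurveDeriv]
    simp only [bracket_eq_pair, hF.varDeriv_eq, hG.varDeriv_eq]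
    have h := (hasDirDeriv_iff_hasCurveDeriv.1 (hQ u v)).pair
      (hD _ _ _ _ (hasCurveDeriv_line u v) (hasDirDeriv_iff_hasCurveDeriv.1 (hP u v)))
    simp only [zero_smul, add_zero] at h
    convert h using 1
    rw [pair_smul_left, pair_add_left, pair_sub_left, pair_add_right, hM, hskew u (P' u v),
      hQs u _ v, pair_comm (P' u v), pair_comm (D u (Q u)), hPs u _ v]
    ring
  constructor
  · intro F G hF hG
    obtain ⟨hF, P', hP, hPs⟩ := hF.exists_secondVariation
    obtain ⟨hG, Q', hQ, hQs⟩ := hG.exists_secondVariation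
    exact ⟨_, key F G _ _ P' Q' hF hG hP hQ hPs hQs⟩
  · intro F G _ _ u
    rw [bracket_eq_pair, bracket_eq_pair, hskew]
  · intro F G K hF hG hK u
    obtain ⟨hF, P', hP, hPs⟩ := hF.exists_secondVariation
    obtain ⟨hG, R', hR, hRs⟩ := hG.exists_secondVariation
    obtain ⟨hK, Q', hQ, hQs⟩ := hK.exists_secondVariation
    rw [bracket_eq_pair D F, bracket_eq_pair D K, bracket_eq_pair D G,
      (key K G _ _ Q' R' hK hG hQ hR hQs hRs).varDeriv_eq,
      (key G F _ _ R' P' hG hF hR hP hRs hPs).varDeriv_eq,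
      (key F K _ _ P' Q' hF hK hP hQ hPs hQs).varDeriv_eq]
    simp only [pair_smul_left, pair_add_left, pair_sub_left, ← hM]
    rw [hRs u (D u (varDeriv K u)), hPs u (D u (varDeriv G u)), hQs u (D u (varDeriv F u))]
    linear_combination 2⁻¹ * hJ u (varDeriv F u) (varDeriv K u) (varDeriv G u)

/-! ### Integrals involving `D_x⁻¹` -/

theorem tendsto_Dinv_atTop (f : 𝓢(ℝ, ℝ)) :
    Tendsto (Dinv f) atTop (𝓝 ((∫ x, f x) / 2)) := by
  have h := (intervalIntegral_tendsto_integral_Ioi 0 (f.integrable (μ := volume)).integrableOn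
    tendsto_id).add_const (Dinv f 0)
  have h1 := intervalIntegral.integral_Iic_add_Ioi (b := (0 : ℝ)) (μ := volume)
    (f.integrable (μ := volume)).integrableOn f.integrable.integrableOn
  convert h using 1
  · funext x
    exact Dinv_eq f.integrable x
  · rw [← h1, Dinv]
    ring_nf

theorem tendsto_Dinv_atBot (f : 𝓢(ℝ, ℝ)) :
    Tendsto (Dinv f) atBot (𝓝 (-((∫ x, f x) / 2))) := by
  have h := (intervalIntegral_tendsto_integral_Iic 0 (f.integrable (μ := volume)).integrableOn
    tendsto_id).neg.add_const (Dinv f 0)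
  have h1 := intervalIntegral.integral_Iic_add_Ioi (b := (0 : ℝ)) (μ := volume)
    (f.integrable (μ := volume)).integrableOn f.integrable.integrableOn
  convert h using 1
  · funext x
    rw [id, ← intervalIntegral.integral_symm]
    exact Dinv_eq f.integrable x
  · rw [← h1, Dinv]
    ring_nf

/-- The rapidly decreasing function `(D_x⁻¹ f) g`. -/
noncomputable def DinvMulReal (f g : 𝓢(ℝ, ℝ)) : 𝓢(ℝ, ℝ) :=
  SchwartzMap.smulLeftCLM ℝ (Dinv f) g

@[simp]
theorem DinvMulReal_apply (f g : 𝓢(ℝ, ℝ)) (x : ℝ) : DinvMulReal f g x = Dinv f x * g x := by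
  simp [DinvMulReal, SchwartzMap.smulLeftCLM_apply_apply (hasTemperateGrowth_Dinv _)]

/-- The integral of a rapidly decreasing function. -/
noncomputable def integral : 𝓢(ℝ, ℝ) →L[ℝ] ℝ := SchwartzMap.integralCLM ℝ volume

/-- Skew-symmetry of `D_x⁻¹`, by parts. The limits of `D_x⁻¹ f` at the two ends are opposite, so the
product of two such functions has equal limits there and the boundary terms cancel. -/
theorem integral_DinvMulReal (f g : 𝓢(ℝ, ℝ)) :
    integral (DinvMulReal f g) = -integral (DinvMulReal g f) := by
  have h := integral_mul_deriv_eq_deriv_mul (u := Dinv f) (v := Dinv g) (u' := f) (v' := g)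
    (fun x _ => hasDerivAt_Dinv f x) (fun x _ => hasDerivAt_Dinv g x)
    ((DinvMulReal f g).integrable.congr (Eventually.of_forall fun x => by simp))
    ((DinvMulReal g f).integrable.congr (Eventually.of_forall fun x => by simp [mul_comm]))
    ((tendsto_Dinv_atBot f).mul (tendsto_Dinv_atBot g))
    ((tendsto_Dinv_atTop f).mul (tendsto_Dinv_atTop g))
  rw [neg_mul_neg, sub_self, zero_sub] at h
  change ∫ x, DinvMulReal f g x = -∫ x, DinvMulReal g f x
  simp only [DinvMulReal_apply]
  rw [h]
  simp only [mul_comm]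

theorem integral_derivCLM (f : 𝓢(ℝ, ℝ)) : integral (SchwartzMap.derivCLM ℝ ℝ f) = 0 := by
  change ∫ x, SchwartzMap.derivCLM ℝ ℝ f x = 0
  refine integral_eq_zero_of_hasDerivAt_of_integrable (f := f) (fun x => ?_)
    (SchwartzMap.integrable _) f.integrable
  rw [SchwartzMap.derivCLM_apply]
  exact f.hasDerivAt x

theorem derivCLM_DinvMulReal_apply (f g : 𝓢(ℝ, ℝ)) (x : ℝ) :
    SchwartzMap.derivCLM ℝ ℝ (DinvMulReal f g) x =
      f x * g x + Dinv f x * SchwartzMap.derivCLM ℝ ℝ g x := by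
  have h := (hasDerivAt_Dinv f x).mul (g.hasDerivAt x)
  have h' : (DinvMulReal f g : ℝ → ℝ) = Dinv f * g := by
    funext y
    simp
  rw [SchwartzMap.derivCLM_apply, h', h.deriv, SchwartzMap.derivCLM_apply]

theorem derivCLM_postcompCLM {F G : Type*} [NormedAddCommGroup F] [NormedSpace ℝ F]
    [NormedAddCommGroup G] [NormedSpace ℝ G] (L : F →L[ℝ] G) (f : 𝓢(ℝ, F)) :
    SchwartzMap.derivCLM ℝ G (SchwartzMap.postcompCLM L f) =
      SchwartzMap.postcompCLM L (SchwartzMap.derivCLM ℝ F f) := by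
  ext x
  have h := L.hasFDerivAt.comp_hasDerivAt x (f.hasDerivAt x)
  rw [SchwartzMap.derivCLM_apply, SchwartzMap.postcompCLM_apply, SchwartzMap.derivCLM_apply]
  exact h.deriv

theorem derivCLM_imMulConj (u w : Phase) :
    SchwartzMap.derivCLM ℝ ℝ (imMulConj u w) =
      imMulConj (SchwartzMap.derivCLM ℝ ℂ u) w + imMulConj u (SchwartzMap.derivCLM ℝ ℂ w) := by
  simp only [imMulConj, derivCLM_postcompCLM, derivCLM_pairing, map_add]

theorem derivCLM_reConjMul (u w : Phase) :
    SchwartzMap.derivCLM ℝ ℝ (reConjMul u w) =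
      reConjMul (SchwartzMap.derivCLM ℝ ℂ u) w + reConjMul u (SchwartzMap.derivCLM ℝ ℂ w) := by
  simp only [reConjMul, derivCLM_postcompCLM, derivCLM_pairing, map_add]

theorem pair_derivCLM (p q : Phase) :
    pair q (SchwartzMap.derivCLM ℝ ℂ p) = -pair p (SchwartzMap.derivCLM ℝ ℂ q) := by
  have h := integral_derivCLM (reConjMul q p)
  rw [derivCLM_reConjMul, map_add] at h
  change pair (SchwartzMap.derivCLM ℝ ℂ q) p + pair q (SchwartzMap.derivCLM ℝ ℂ p) = 0 at h
  rw [pair_comm p]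
  linarith

theorem pair_I_smul_opT (r a b q : Phase) :
    pair r (Complex.I • opT a b q) = -integral (DinvMulReal (imMulConj b q) (imMulConj a r)) := by
  rw [pair_eq_integral, ← map_neg]
  refine integral_congr_ae (Eventually.of_forall fun x => ?_)
  simp
  ring

/-! ### The operator `H` and its derivative -/

theorem opH_eq (u w : Phase) :
    opH u w = SchwartzMap.derivCLM ℝ ℂ w - Complex.I • opT u u w := rfl

theorem opI_eq (u w : Phase) : opI u w = -(Complex.I • w) := by
  change (-Complex.I) • w = _
  rw [neg_smul]

theorem opIinv_eq (u w : Phase) : opIinv u w = Complex.I • w := by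
  change mulNegI.symm w = _
  rw [LinearEquiv.symm_apply_eq]
  change w = (-Complex.I) • Complex.I • w
  simp [smul_smul]

theorem opRstar_eq (u w : Phase) : opRstar u w = Complex.I • opH u w :=
  opIinv_eq u _

theorem opR_eq (u w : Phase) : opR u w = opH u (Complex.I • w) := by
  rw [← opIinv_eq u w]
  rfl

theorem opE_eq (u w : Phase) : opE u w = opH u (opRstar u w) := by
  rw [opRstar_eq, ← opR_eq]
  rfl

theorem opH_eq_opRstar (u w : Phase) : opH u w = -(Complex.I • opRstar u w) := by
  rw [opRstar_eq, smul_smul]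
  simp

/-- The derivative `H'_u[v] w`. -/
noncomputable def opH' (u v w : Phase) : Phase := -(Complex.I • (opT v u w + opT u v w))

theorem opT_sub_opT (a b c a₀ b₀ c₀ : Phase) :
    opT a b c - opT a₀ b₀ c₀ =
      opT (a - a₀) b c + opT a₀ (b - b₀) c + opT a₀ b₀ (c - c₀) := by
  have h1 : imMulConj (b - b₀) c = imMulConj b c - imMulConj b₀ c := by
    ext x
    simp [-Complex.mul_im, sub_mul]
  have h2 : imMulConj b₀ (c - c₀) = imMulConj b₀ c - imMulConj b₀ c₀ := by
    ext x
    simp [-Complex.mul_im, mul_sub]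
  ext x
  simp [h1, h2]
  ring

theorem opT_smul_left (t : ℝ) (a b c : Phase) : opT (t • a) b c = t • opT a b c := by
  ext x
  simp
  ring

theorem opT_smul_mid (t : ℝ) (a b c : Phase) : opT a (t • b) c = t • opT a b c := by
  have h1 : imMulConj (t • b) c = t • imMulConj b c := by
    ext x
    simp
    ring
  ext x
  simp [h1]
  ring

theorem opT_smul_right (t : ℝ) (a b c : Phase) : opT a b (t • c) = t • opT a b c := by
  have h1 : imMulConj b (t • c) = t • imMulConj b c := by
    ext x
    simp
    ring
  ext x
  simp [h1]
  ring

/-- Telescoping a trilinear expression; joint continuity passes each of the three difference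
quotients to the limit. -/
theorem HasCurveDeriv.opT {γ η ζ : ℝ → Phase} {a b c : Phase}
    (hγ : HasCurveDeriv γ a) (hη : HasCurveDeriv η b) (hζ : HasCurveDeriv ζ c) :
    HasCurveDeriv (fun t => opT (γ t) (η t) (ζ t))
      (opT a (η 0) (ζ 0) + opT (γ 0) b (ζ 0) + opT (γ 0) (η 0) c) := by
  refine (((tendsto_opT hγ hη.tendsto hζ.tendsto).add
    (tendsto_opT tendsto_const_nhds hη hζ.tendsto)).add
    (tendsto_opT tendsto_const_nhds tendsto_const_nhds hζ)).congr fun t => ?_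
  rw [opT_smul_left, opT_smul_mid, opT_smul_right, ← smul_add, ← smul_add, opT_sub_opT]

theorem hasCurveVariation_opH : HasCurveVariation opH opH' := by
  intro γ η a b hγ hη
  simp only [opH_eq, sub_eq_add_neg]
  have h := (hη.map (SchwartzMap.derivCLM ℝ ℂ)).add ((hγ.opT hγ hη).I_smul.const_smul (-1))
  simp only [neg_smul, one_smul] at h
  convert h using 1
  simp only [opH', smul_add]
  abel

theorem isSkew_opH : IsSkew opH := by
  intro u p q
  rw [opH_eq, opH_eq, pair_sub_right, pair_sub_right, pair_I_smul_opT, pair_I_smul_opT,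
    pair_derivCLM, integral_DinvMulReal]
  ring

/-- Skew-symmetry moves `D_x⁻¹` off `v`. The result is local in `v`, which allows transposition, and
visibly antisymmetric in `q` and `r`. -/
theorem pair_opH' (u v q r : Phase) :
    pair r (opH' u v q) = integral (DinvMulReal (imMulConj u q) (imMulConj v r) -
      DinvMulReal (imMulConj u r) (imMulConj v q)) := by
  rw [opH', smul_add, pair_neg_right, pair_add_right, pair_I_smul_opT, pair_I_smul_opT,
    integral_DinvMulReal (imMulConj v q), map_sub]
  ring

/-- The covector `M` with `⟨r, H'[v] q⟩ = ⟨M, v⟩`. -/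
noncomputable def gradH (u q r : Phase) : Phase :=
  Complex.I • (opT r u q - opT q u r)

theorem pair_opH'_eq_gradH (u v q r : Phase) : pair r (opH' u v q) = pair (gradH u q r) v := by
  rw [pair_opH', pair_eq_integral]
  refine integral_congr_ae (Eventually.of_forall fun x => ?_)
  simp [gradH]
  ring

/-- `⟨r, H'[I p] q⟩`. -/
noncomputable def formH (u p q r : Phase) : ℝ := pair r (opH' u (-(Complex.I • p)) q)

theorem pair_opH'_skew (u v q r : Phase) : pair r (opH' u v q) = -pair q (opH' u v r) := by
  rw [pair_opH', pair_opH', ← map_neg, neg_sub]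

theorem formH_skew (u p q r : Phase) : formH u p q r = -formH u p r q :=
  pair_opH'_skew _ _ _ _

theorem formH_add (u p₁ p₂ q r : Phase) :
    formH u (p₁ + p₂) q r = formH u p₁ q r + formH u p₂ q r := by
  simp only [formH, pair_opH'_eq_gradH, smul_add, neg_add, pair_add_right]

theorem formH_smul (u : Phase) (c : ℝ) (p q r : Phase) :
    formH u (c • p) q r = c * formH u p q r := by
  simp only [formH, pair_opH'_eq_gradH, smul_comm Complex.I c, ← smul_neg, pair_smul_right]

/-- With `v = -i p`, the factor `Im (v r̄)` becomes `-Re (p r̄)`, which is symmetric in `p` and `r`;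
the six terms of the integrand cancel in pairs. -/
theorem formH_cyclic (u p q r : Phase) :
    formH u p q r + formH u q r p + formH u r p q = 0 := by
  simp only [formH, pair_opH', ← map_add]
  convert map_zero integral using 2
  ext x
  simp
  ring

/-- Here the direction is `H p`. Its nonlocal part gives products of two `D_x⁻¹` factors with a
symmetric real part, which cancel cyclically. Its part `p_x` assembles into an exact derivative. -/
theorem formH_opRstar_cyclic (u p q r : Phase) :
    formH u (opRstar u p) q r + formH u (opRstar u q) r p + formH u (opRstar u r) p q = 0 := by
  simp only [formH, ← opH_eq_opRstar, pair_opH', ← map_add]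
  -- When this primitive is differentiated, the terms without `D_x⁻¹` sum to zero by the Plücker
  -- relation for the four plane vectors `u, p, q, r`.
  rw [← integral_derivCLM (DinvMulReal (imMulConj u q) (imMulConj p r) +
    DinvMulReal (imMulConj u r) (imMulConj q p) + DinvMulReal (imMulConj u p) (imMulConj r q))]
  congr 1
  ext x
  simp only [map_add, add_apply, sub_apply, derivCLM_DinvMulReal_apply,
    derivCLM_imMulConj, DinvMulReal_apply, imMulConj_apply, opH_eq, smul_apply,
    opT_apply]
  simp
  ring

/-! ### Hamiltonian property of linear combinations of `E`, `H` and `I` -/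

theorem neg_I_smul_I_smul (v : Phase) : -(Complex.I • Complex.I • v) = v := by
  simp [smul_smul]

theorem pair_opH'_opH (u p q r : Phase) :
    pair r (opH' u (opH u p) q) = formH u (opRstar u p) q r := by
  rw [formH, ← opH_eq_opRstar]

theorem isAdjointOf_opRstar_opR : IsAdjointOf opRstar opR := by
  intro u P v
  rw [opR_eq, opRstar_eq, isSkew_opH, pair_comm, pair_I_smul_right, neg_neg]

/-- The derivative `E'_u[v] w`. -/
noncomputable def opE' (u v w : Phase) : Phase :=
  opH' u v (opRstar u w) + opH u (Complex.I • opH' u v w)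

/-- `E = H i H`, and derivatives along curves compose: the inner `H` yields a differentiable curve
to which the rule for the outer `H` applies. -/
theorem hasCurveVariation_opE : HasCurveVariation opE opE' := by
  intro γ η a b hγ hη
  simp only [opE_eq, opRstar_eq]
  have h := hasCurveVariation_opH _ _ _ _ hγ (hasCurveVariation_opH _ _ _ _ hγ hη).I_smul
  convert h using 1
  rw [opE', opRstar_eq, smul_add, map_add, add_assoc]

theorem isSkew_opE : IsSkew opE := by
  intro u p q
  rw [opE_eq, opE_eq, opRstar_eq, opRstar_eq, isSkew_opH, isSkew_opH u _ p, pair_comm _ (opH u q),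
    pair_I_smul_right, pair_comm]

theorem pair_opE' (u v q r : Phase) :
    pair r (opE' u v q) = pair r (opH' u v (opRstar u q)) + pair (opRstar u r) (opH' u v q) := by
  rw [opE', pair_add_right, ← opR_eq, isAdjointOf_opRstar_opR]

theorem combination_apply (a b c : ℝ) (u w : Phase) :
    (a • opE + b • opH + c • opI) u w = a • opE u w + b • opH u w + c • opI u w := rfl

theorem combination_eq_neg_I_smul (a b c : ℝ) (u p : Phase) :
    (a • opE + b • opH + c • opI) u p =
      -(Complex.I • (a • opRstar u (opRstar u p) + b • opRstar u p + c • p)) := by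
  rw [combination_apply, opE_eq, opH_eq_opRstar u (opRstar u p), opH_eq_opRstar u p, opI_eq]
  simp only [smul_add, neg_add, smul_neg, smul_comm Complex.I]

theorem hasCurveVariation_combination (a b c : ℝ) :
    HasCurveVariation (a • opE + b • opH + c • opI)
      (fun u v w => a • opE' u v w + b • opH' u v w) := by
  intro γ η p q hγ hη
  simp only [combination_apply, opI_eq]
  have h := (((hasCurveVariation_opE _ _ _ _ hγ hη).const_smul a).add
    ((hasCurveVariation_opH _ _ _ _ hγ hη).const_smul b)).add (hη.I_smul.const_smul (-c))
  simp only [neg_smul, ← smul_neg c] at h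
  convert h using 1
  simp only [smul_add]
  abel

theorem isHamiltonian_combination (a b c : ℝ) :
    IsHamiltonian (a • opE + b • opH + c • opI) := by
  refine isHamiltonian_of_jacobi ?_ (hasCurveVariation_combination a b c) ?_ ?_
  · intro u p q
    have h : pair q (opI u p) = -pair p (opI u q) := by
      rw [opI_eq, opI_eq, pair_neg_right, pair_neg_right, pair_I_smul_right, pair_comm]
    simp only [combination_apply, pair_add_right, pair_smul_right]
    rw [isSkew_opE, isSkew_opH, h]
    ring
  · intro u q r
    -- The variation of `E = R H` has two terms: `S` acts on `q` in one, and by adjointness on `r`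
    -- in the other. The constant operator `I` contributes nothing.
    refine ⟨a • (gradH u (opRstar u q) r + gradH u q (opRstar u r)) + b • gradH u q r,
      fun v => ?_⟩
    simp only [pair_add_right, pair_smul_right, pair_add_left, pair_smul_left, pair_opE',
      pair_opH'_eq_gradH]
  · intro u p q r
    simp only [pair_add_right, pair_smul_right, pair_opE', combination_eq_neg_I_smul]
    simp only [← formH.eq_def, formH_add, formH_smul]
    set S := opRstar u
    have hI := formH_cyclic u
    have hH := formH_opRstar_cyclic u
    -- Sorted by powers of `S`. In the `a ^ 2` and `a * c` parts the two subtracted identities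
    -- remove the terms that the Jacobi expression does not contain.
    linear_combination
      a ^ 2 * (hH (S p) (S q) r + hH (S q) (S r) p + hH (S r) (S p) q - hI (S p) (S q) (S r)) +
      a * b * (hH p q (S r) + hH q r (S p) + hH r p (S q)) +
      a * c * (hI (S p) q r + hI p (S q) r + hI p q (S r) - hH p q r) +
      b ^ 2 * hH p q r + b * c * hI p q r

/-! ### Hereditary recursion operators -/

theorem hasVariation_opR : HasVariation opR (fun u v w => opH' u v (Complex.I • w)) := by
  intro u v w
  simp only [opR_eq]
  exact hasCurveVariation_opH.hasVariation u v (Complex.I • w)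

theorem hasVariation_opRstar : HasVariation opRstar (fun u v P => Complex.I • opH' u v P) := by
  intro u v P
  rw [hasDirDeriv_iff_hasCurveDeriv]
  simp only [opRstar_eq]
  exact (hasDirDeriv_iff_hasCurveDeriv.1 (hasCurveVariation_opH.hasVariation u v P)).I_smul

/-- The variation of `R*` is the adjoint of that of `R`, which carries the covector statements back
to flow vectors. -/
theorem pair_I_smul_opH' (u v P w : Phase) :
    pair (Complex.I • opH' u v P) w = pair P (opH' u v (Complex.I • w)) := by
  rw [pair_opH'_skew, pair_comm (Complex.I • w), pair_I_smul_right, neg_neg]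

theorem pair_opH'_eq_formH (u v q r : Phase) :
    pair r (opH' u v q) = formH u (Complex.I • v) q r := by
  rw [formH, neg_I_smul_I_smul]

/-- Take the two cyclic identities at `i v`, `i w`, with `S` applied to every first slot in one and
to `r` in the other. The term `B(S r, i v, i w)` is common to both and drops out of the difference.
-/
theorem isHereditary_opR : IsHereditary opR := by
  refine ⟨_, hasVariation_opR, fun u v w => eq_of_forall_pair_right fun r => ?_⟩
  simp only [pair_sub_right, isAdjointOf_opRstar_opR u r, opR_eq u v, opR_eq u w,
    pair_opH'_eq_formH, ← opRstar_eq]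
  have h1 := formH_opRstar_cyclic u (Complex.I • v) (Complex.I • w) r
  have h2 := formH_cyclic u (Complex.I • v) (Complex.I • w) (opRstar u r)
  rw [formH_skew u _ r] at h1
  rw [formH_skew u _ (opRstar u r)] at h2
  linear_combination h1 - h2

theorem isCoHereditary_opRstar : IsCoHereditary opRstar := by
  refine ⟨opR, _, isAdjointOf_opRstar_opR, hasVariation_opRstar, fun u P v w => ?_⟩
  simp only [pair_I_smul_opH', opR_eq, pair_opH'_eq_formH, ← opRstar_eq]
  have h1 := formH_opRstar_cyclic u (Complex.I • v) (Complex.I • w) P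
  have h2 := formH_cyclic u (Complex.I • v) (Complex.I • w) (opRstar u P)
  rw [formH_skew u _ P] at h1
  rw [formH_skew u _ (opRstar u P)] at h2
  linear_combination h1 - h2

/-- `K'` has two expressions, one from each Hamiltonian structure. The `I` form and the Hessian of
`G` transpose `K'`; then the `H` form is inserted, the Hessian of `F` cancels, and the Jacobi
condition for `H` is left. -/
theorem exists_recursion {K : Phase → Phase} (hK : IsBiHamiltonianFlow opH opI K) :
    ∃ K' : Phase → Phase → Phase, (∀ u v, HasDirDeriv K u v (K' u v)) ∧
      ∀ u w, opH' u (K u) (Complex.I • w) = K' u (opR u w) - opR u (K' u w) := by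
  obtain ⟨F, G, hF, hG, hKF, hKG⟩ := hK
  obtain ⟨hF, P', hP, hPs⟩ := hF.exists_secondVariation
  obtain ⟨hG, Q', hQ, hQs⟩ := hG.exists_secondVariation
  have hK' : ∀ u v, HasDirDeriv K u v (-(Complex.I • Q' u v)) := by
    intro u v
    have h := ((hasDirDeriv_iff_hasCurveDeriv.1 (hQ u v)).I_smul).const_smul (-1)
    rw [hasDirDeriv_iff_hasCurveDeriv]
    simpa only [hKG, opI_eq, neg_smul, one_smul] using h
  have hK'' : ∀ u v, -(Complex.I • Q' u v) = opH' u v (varDeriv F u) + opH u (P' u v) := by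
    intro u v
    refine (hasDirDeriv_iff_hasCurveDeriv.1 (hK' u v)).unique ?_
    have h := hasCurveVariation_opH _ _ _ _ (hasCurveDeriv_line u v)
      (hasDirDeriv_iff_hasCurveDeriv.1 (hP u v))
    simpa only [hKF, zero_smul, add_zero] using h
  refine ⟨_, hK', fun u w => eq_of_forall_pair_right fun r => ?_⟩
  have h1 : pair (opRstar u r) (-(Complex.I • Q' u w)) =
      pair (Complex.I • w) (-(Complex.I • Q' u (opH u r))) := by
    rw [pair_neg_right, pair_neg_right, pair_I_smul_right, pair_I_smul_right, opRstar_eq,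
      smul_smul, smul_smul, Complex.I_mul_I, neg_one_smul, neg_one_smul, pair_neg_left,
      pair_neg_left, pair_comm _ (Q' u w), hQs, pair_comm w]
  rw [pair_sub_right, isAdjointOf_opRstar_opR, h1, hK'', hK'', hKF, opR_eq, pair_opH'_opH,
    pair_add_right, pair_add_right, pair_opH'_opH, pair_opH'_opH, isSkew_opH u _ r,
    isSkew_opH u _ (Complex.I • w), hPs u (opH u r)]
  have h2 := formH_opRstar_cyclic u (Complex.I • w) (varDeriv F u) r
  rw [formH_skew u _ r, formH_skew u _ (Complex.I • w) (varDeriv F u)] at h2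
  linear_combination -h2

theorem isRecursionFor_opR {K : Phase → Phase} (hK : IsBiHamiltonianFlow opH opI K) :
    IsRecursionFor opR K := by
  obtain ⟨K', hK', h⟩ := exists_recursion hK
  exact ⟨_, K', hasVariation_opR, hK', h⟩

theorem isCoRecursionFor_opRstar {K : Phase → Phase} (hK : IsBiHamiltonianFlow opH opI K) :
    IsCoRecursionFor opRstar K := by
  obtain ⟨K', hK', h⟩ := exists_recursion hK
  refine ⟨opR, _, K', isAdjointOf_opRstar_opR, hasVariation_opRstar, hK', fun u P w => ?_⟩
  rw [pair_I_smul_opH', h, pair_sub_right, isAdjointOf_opRstar_opR]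

/-! ### Invariance under phase rotations -/

theorem exp_neg_smul_exp_smul (l : ℝ) (w : Phase) :
    Complex.exp (-(Complex.I * l)) • Complex.exp (Complex.I * l) • w = w := by
  rw [smul_smul, ← Complex.exp_add, neg_add_cancel, Complex.exp_zero, one_smul]

theorem IsU1Invariant.comp {A B : OpField} (hA : IsU1Invariant A) (hB : IsU1Invariant B) :
    IsU1Invariant fun u => A u ∘ₗ B u := by
  intro l u w
  simp only [LinearMap.comp_apply]
  rw [← hA, ← hB, exp_neg_smul_exp_smul]

theorem derivCLM_const_smul (c : ℂ) (w : Phase) :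
    SchwartzMap.derivCLM ℝ ℂ (c • w) = c • SchwartzMap.derivCLM ℝ ℂ w := by
  ext x
  rw [smul_apply, SchwartzMap.derivCLM_apply, SchwartzMap.derivCLM_apply]
  exact ((w.hasDerivAt x).const_smul c).deriv

theorem isU1Invariant_opH : IsU1Invariant opH := by
  intro l u w
  -- A phase on `u` is the opposite phase on `w`, because `w` enters conjugated.
  have h : imMulConj (Complex.exp (Complex.I * l) • u) w =
      imMulConj u (Complex.exp (-(Complex.I * l)) • w) := by
    ext x
    simp only [imMulConj_apply, smul_apply, smul_eq_mul, map_mul, ← Complex.exp_conj, map_neg,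
      Complex.conj_I, Complex.conj_ofReal, neg_mul, neg_neg]
    ring_nf
  have hc := Complex.exp_add (Complex.I * l) (-(Complex.I * l))
  rw [add_neg_cancel, Complex.exp_zero] at hc
  rw [opH_eq, opH_eq, derivCLM_const_smul, smul_sub, smul_smul, ← hc, one_smul]
  congr 1
  ext x
  simp only [opT, h, smul_apply, smul_eq_mul, DinvMul_apply]
  ring

theorem isU1Invariant_opI : IsU1Invariant opI := by
  intro l u w
  simp only [opI_eq, smul_neg, smul_smul]
  rw [mul_left_comm, ← Complex.exp_add, add_neg_cancel, Complex.exp_zero, mul_one]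

theorem isU1Invariant_opIinv : IsU1Invariant opIinv := by
  intro l u w
  simp only [opIinv_eq, smul_smul]
  rw [mul_left_comm, ← Complex.exp_add, add_neg_cancel, Complex.exp_zero, mul_one]

/-! ### Explicit formulas -/

theorem Dinv_neg (f : ℝ → ℝ) (x : ℝ) : Dinv (fun y => -f y) x = -Dinv f x := by
  have h := congrFun (Dinv_smul (-1) f) x
  rw [neg_one_smul, neg_one_smul] at h
  exact h

theorem Dinv_derivCLM (f : 𝓢(ℝ, ℝ)) (x : ℝ) : Dinv (SchwartzMap.derivCLM ℝ ℝ f) x = f x := by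
  have hd : ∀ y, HasDerivAt f (SchwartzMap.derivCLM ℝ ℝ f y) y := fun y => by
    rw [SchwartzMap.derivCLM_apply]
    exact f.hasDerivAt y
  have hi : Integrable (SchwartzMap.derivCLM ℝ ℝ f) volume := SchwartzMap.integrable _
  rw [Dinv, integral_Iic_of_hasDerivAt_of_tendsto' (fun y _ => hd y) hi.integrableOn
      (f.tendsto_cocompact.mono_left atBot_le_cocompact),
    integral_Ioi_of_hasDerivAt_of_tendsto' (fun y _ => hd y) hi.integrableOn
      (f.tendsto_cocompact.mono_left atTop_le_cocompact)]
  ring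

theorem opR_apply (u w : Phase) (x : ℝ) : opR u w x =
    Complex.I * (deriv w x + u x * (Dinv (fun y => (u y * conj (w y)).re) x : ℂ)) := by
  have h : (fun y => (u y * conj ((Complex.I • w) y)).im) = fun y => -(u y * conj (w y)).re := by
    funext y
    simp [neg_add_eq_sub]
  rw [opR_eq, opH_apply, h, Dinv_neg, ← SchwartzMap.derivCLM_apply ℝ,
    ← SchwartzMap.derivCLM_apply ℝ, derivCLM_const_smul, smul_apply, smul_eq_mul]
  push_cast
  ring

theorem opRstar_apply (u w : Phase) (x : ℝ) : opRstar u w x = Complex.I * deriv w x -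
    u x * (Dinv (fun y => (Complex.I * u y * conj (w y)).re) x : ℂ) := by
  have h : (fun y => (Complex.I * u y * conj (w y)).re) = fun y => -(u y * conj (w y)).im := by
    funext y
    simp [neg_add_eq_sub]
  rw [opRstar_eq, smul_apply, smul_eq_mul, opH_apply, h, Dinv_neg]
  push_cast
  linear_combination -u x * Dinv (fun y => (u y * conj (w y)).im) x * Complex.I_mul_I

theorem hasDerivAt_Dinv_imMulConj (u w : Phase) (x : ℝ) :
    HasDerivAt (fun z => u z * (Dinv (fun y => (u y * conj (w y)).im) z : ℂ))
      (deriv u x * (Dinv (fun y => (u y * conj (w y)).im) x : ℂ) +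
        u x * ((u x * conj (w x)).im : ℂ)) x := by
  have h : (imMulConj u w : ℝ → ℝ) = fun y => (u y * conj (w y)).im := by
    funext y
    exact imMulConj_apply u w y
  have h1 := (u.hasDerivAt x).mul (hasDerivAt_Dinv (imMulConj u w) x).ofReal_comp
  rw [imMulConj_apply, h] at h1
  exact h1

theorem opE_apply (u w : Phase) (x : ℝ) : opE u w x =
    Complex.I * deriv (deriv w) x +
      deriv (fun z => u z * (Dinv (fun y => (u y * conj (w y)).im) z : ℂ)) x +
      Complex.I * u x * (Dinv (fun y => (u y * conj (deriv w y)).re) x : ℂ) := by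
  have h1 : (opH u w : ℝ → ℂ) = fun z => deriv w z -
      Complex.I * (u z * (Dinv (fun y => (u y * conj (w y)).im) z : ℂ)) := by
    funext z
    rw [opH_apply, mul_assoc]
  -- The nonlocal part of `H w` is `-i u` times a real function, so it contributes only `i |u|²`
  -- times a real function, with no real part.
  have h2 : (fun y => (u y * conj (opH u w y)).re) = fun y => (u y * conj (deriv w y)).re := by
    funext y
    simp [h1]
    ring
  have hd : HasDerivAt (deriv w) (deriv (deriv w) x) x := by
    have h := (SchwartzMap.derivCLM ℝ ℂ w).hasDerivAt x
    have h' : (SchwartzMap.derivCLM ℝ ℂ w : ℝ → ℂ) = deriv w := by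
      funext y
      exact SchwartzMap.derivCLM_apply ℝ w y
    rwa [h'] at h
  have hp := hasDerivAt_Dinv_imMulConj u w x
  have h3 := (hd.sub (hp.const_mul Complex.I)).deriv
  change deriv (fun z => deriv w z -
    Complex.I * (u z * (Dinv (fun y => (u y * conj (w y)).im) z : ℂ))) x = _ at h3
  rw [← h1] at h3
  change opR u (opH u w) x = _
  rw [opR_apply, h2, h3, hp.deriv]
  linear_combination -(deriv u x * (Dinv (fun y => (u y * conj (w y)).im) x : ℂ) +
        u x * ((u x * conj (w x)).im : ℂ)) * Complex.I_mul_I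

/-- `D_x⁻¹ D_x` is the identity on decaying functions; apply it to `Re (u w̄)`. -/
theorem Dinv_re_mul_conj_deriv (u w : Phase) (x : ℝ) :
    Dinv (fun y => (u y * conj (deriv w y)).re) x =
      (u x * conj (w x)).re - Dinv (fun y => (deriv u y * conj (w y)).re) x := by
  have h := Dinv_derivCLM (reConjMul w u) x
  rw [derivCLM_reConjMul] at h
  have h1 : (reConjMul (SchwartzMap.derivCLM ℝ ℂ w) u : ℝ → ℝ) =
      fun y => (u y * conj (deriv w y)).re := by
    funext y
    rw [reConjMul_apply, SchwartzMap.derivCLM_apply, mul_comm]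
  have h2 : (reConjMul w (SchwartzMap.derivCLM ℝ ℂ u) : ℝ → ℝ) =
      fun y => (deriv u y * conj (w y)).re := by
    funext y
    rw [reConjMul_apply, SchwartzMap.derivCLM_apply, mul_comm]
  have h3 := (Dinv_add_apply (reConjMul (SchwartzMap.derivCLM ℝ ℂ w) u)
    (reConjMul w (SchwartzMap.derivCLM ℝ ℂ u)) x).symm.trans h
  rw [h1, h2, reConjMul_apply, mul_comm (conj (w x))] at h3
  linarith

theorem opE_apply' (u w : Phase) (x : ℝ) : opE u w x =
    Complex.I * deriv (deriv w) x + Complex.I * ((‖u x‖ ^ 2 : ℝ) : ℂ) * w x +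
      deriv u x * (Dinv (fun y => (u y * conj (w y)).im) x : ℂ) -
      Complex.I * u x * (Dinv (fun y => (deriv u y * conj (w y)).re) x : ℂ) := by
  rw [opE_apply, (hasDerivAt_Dinv_imMulConj u w x).deriv, Dinv_re_mul_conj_deriv]
  -- The two local terms, `u Im (u w̄)` and `i u Re (u w̄)`, combine through this conjugate into `i
  -- |u|² w`.
  have h1 : ((u x * conj (w x)).re : ℂ) - Complex.I * ((u x * conj (w x)).im : ℂ) =
      conj (u x) * w x := by
    apply Complex.ext <;> simp; ring
  have h2 : ((‖u x‖ ^ 2 : ℝ) : ℂ) = conj (u x) * u x := by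
    rw [Complex.conj_mul']
    push_cast
    rfl
  rw [h2]
  push_cast
  linear_combination Complex.I * u x * h1 +
    u x * ((u x * conj (w x)).im : ℂ) * Complex.I_mul_I

end HasimotoFlow

open HasimotoFlow in
theorem mainTheorem6 :
    -- (i)
    (IsHamiltonian opH ∧ IsU1Invariant opH) ∧
    -- (ii)
    (IsHamiltonian opI ∧ IsU1Invariant opI) ∧
    -- (iii)
    ((∀ a b : ℝ, IsHamiltonian (a • opH + b • opI)) ∧
      (IsU1Invariant opR ∧ IsHereditary opR ∧
        ∀ K, IsBiHamiltonianFlow opH opI K → IsRecursionFor opR K) ∧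
      (IsU1Invariant opRstar ∧ IsAdjointOf opRstar opR ∧ IsCoHereditary opRstar ∧
        ∀ K, IsBiHamiltonianFlow opH opI K → IsCoRecursionFor opRstar K) ∧
      (∀ (u w : Phase) (x : ℝ), opR u w x =
        Complex.I * (deriv w x + u x * (Dinv (fun y => (u y * conj (w y)).re) x : ℂ))) ∧
      (∀ (u w : Phase) (x : ℝ), opRstar u w x =
        Complex.I * deriv w x -
          u x * (Dinv (fun y => (Complex.I * u y * conj (w y)).re) x : ℂ))) ∧
    -- (iv)
    ((IsHamiltonian opE ∧ IsU1Invariant opE) ∧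
      (∀ (u w : Phase) (x : ℝ), opE u w x =
        Complex.I * deriv (deriv w) x +
          deriv (fun z => u z * (Dinv (fun y => (u y * conj (w y)).im) z : ℂ)) x +
          Complex.I * u x * (Dinv (fun y => (u y * conj (deriv w y)).re) x : ℂ)) ∧
      (∀ (u w : Phase) (x : ℝ), opE u w x =
        Complex.I * deriv (deriv w) x + Complex.I * ((‖u x‖ ^ 2 : ℝ) : ℂ) * w x +
          deriv u x * (Dinv (fun y => (u y * conj (w y)).im) x : ℂ) -
          Complex.I * u x * (Dinv (fun y => (deriv u y * conj (w y)).re) x : ℂ)) ∧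
      (∀ a b c : ℝ, IsHamiltonian (a • opE + b • opH + c • opI))) := by
  -- Every Hamiltonian claim is the compatible triple with some coefficients set to `0` or `1`.
  have hHI : ∀ a b : ℝ, IsHamiltonian (a • opH + b • opI) := fun a b => by
    simpa using isHamiltonian_combination 0 a b
  have hR : IsU1Invariant opR := isU1Invariant_opH.comp isU1Invariant_opIinv
  refine ⟨⟨by simpa using hHI 1 0, isU1Invariant_opH⟩, ⟨by simpa using hHI 0 1, isU1Invariant_opI⟩,
    ⟨hHI, ⟨hR, isHereditary_opR, fun K hK => isRecursionFor_opR hK⟩,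
      ⟨isU1Invariant_opIinv.comp isU1Invariant_opH, isAdjointOf_opRstar_opR,
        isCoHereditary_opRstar, fun K hK => isCoRecursionFor_opRstar hK⟩,
      opR_apply, opRstar_apply⟩,
    ⟨by simpa using isHamiltonian_combination 1 0 0, hR.comp isU1Invariant_opH⟩,
    opE_apply, opE_apply', isHamiltonian_combination⟩
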